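/- All languages are predicate languages: they consist of predicate symbols of arities $\ge 1$. Structures are non-empty, and $\mathrm{Th}(\mathcal A)$ denotes the complete first-order theory of $\mathcal A$. Let $T$ be a complete theory in a language $\Sigma$. An $n$-ary symbol $R\in\Sigma$ is non-empty (respectively, empty) for $T$ if $T\vdash\exists\bar x\,R(\bar x)$ (respectively, $T\vdash\neg\exists\bar x\,R(\bar x)$). The theory $T$ is an LU-theory if for each $n$ every permutation of the set of non-empty $n$-ary predicates preserves $T$. It is an IILU-theory if, moreover, it has a non-empty predicate and, for every $n$ for which there is a non-empty $n$-ary predicate, there are infinitely many non-empty and infinitely many empty $n$-ary predicates. For a non-empty family $(\mathcal A_i)_{i\in I}$ of $\Sigma$-structures, let $\mathcal A_E=\mathrm{Comb}_E(\mathcal A_i)_{i\in I}$ be their disjoint union (each predicate of $\Sigma$ being the union of its interpretations in the $\mathcal A_i$) expanded by a new binary predicate $E$, the equivalence relation whose classes are the universes of the $\mathcal A_i$. If every $\mathrm{Th}(\mathcal A_i)$ is an IILU-theory, then $T=\mathrm{Th}(\mathcal A_E)$ is called an $E$-combination of IILU-theories in the language $\Sigma$. For a model $\mathcal M$ of such a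 $T$, let $\mathrm{TH}(\mathcal M)$ be the set of the theories of the restrictions of $\mathcal M$ to its $E$-classes, regarded as $\Sigma$-structures. The model $\mathcal M$ is $e$-least if $\mathrm{TH}(\mathcal M)\subseteq\mathrm{TH}(\mathcal N)$ for every $\mathcal N\models T$. The $e$-spectrum of $\mathcal M$ is the cardinality $$e\text{-}\mathrm{Sp}(\mathcal M)=\Bigl|\bigcup_{\mathcal N\equiv\mathcal M}\mathrm{TH}(\mathcal N)\setminus\mathrm{TH}(\mathcal M)\Bigr|,$$ and $e\text{-}\mathrm{Sp}(T)=\sup\{e\text{-}\mathrm{Sp}(\mathcal M)\mid\mathcal M\models T\}$. **Proposition 5.2.** (1) For every cardinal $\mu\le\omega$ there is an $E$-combination $T=\mathrm{Th}(\mathcal A_E)$ of IILU-theories in a language $\Sigma$ of cardinality $\omega$ such that $T$ has an $e$-least model and $e\text{-}\mathrm{Sp}(T)=\mu$. (2) For every uncountable cardinal $\lambda$ there is an $E$-combination $T=\mathrm{Th}(\mathcal A_E)$ of IILU-theories in a language $\Sigma$ of cardinality $\lambda$ such that $T$ has an $e$-least model and $e\text{-}\mathrm{Sp}(T)=\lambda$.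 -/

import Mathlib

open FirstOrder Cardinal

universe u

namespace ECombination

/-- A predicate language: no function or constant symbols, and every predicate symbol has
arity at least one. -/
class IsPredicate (L : FirstOrder.Language.{0, u}) : Prop where
  isEmpty_functions : ∀ n, IsEmpty (L.Functions n)
  isEmpty_nullary : IsEmpty (L.Relations 0)

/-- The relation symbols of `withE L`: those of `L` and a new binary symbol `E`. -/
inductive RelE (L : FirstOrder.Language.{0, u}) : ℕ → Type u
  | base {n : ℕ} (R : L.Relations n) : RelE L n
  | E : RelE L 2

/-- The language `L ∪ {E}` with a new binary predicate symbol `E`. -/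
def withE (L : FirstOrder.Language.{0, u}) : FirstOrder.Language.{0, u} := ⟨L.Functions, RelE L⟩

section Structures

variable {L : FirstOrder.Language.{0, u}} [IsPredicate L]

/-- The disjoint union of the `L`-structures `A i`, each predicate of `L` being the union of the
corresponding predicates of the `A i`, and the classes of the equivalence relation `E` being the
summands: this is the combination `Comb_E (A i)`. -/
instance combE {ι : Type u} (A : ι → Type u) [∀ i, L.Structure (A i)] :
    (withE L).Structure (Σ i, A i) where
  funMap {n} f := ((IsPredicate.isEmpty_functions (L := L) n).false f).elim
  RelMap R := match R with
    | .base R => fun x => ∃ (i : ι) (y : Fin _ → A i),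
        (∀ k, x k = ⟨i, y k⟩) ∧ FirstOrder.Language.Structure.RelMap R y
    | .E => fun x => (x 0).1 = (x 1).1

/-- `a` and `b` are related by `E`. -/
def relE {M : Type u} [(withE L).Structure M] (a b : M) : Prop :=
  FirstOrder.Language.Structure.RelMap (L := withE L) (RelE.E : RelE L 2) ![a, b]

variable (L) in
/-- The `E`-class of `a`. -/
def EClass {M : Type u} [(withE L).Structure M] (a : M) : Type u :=
  {b : M // relE (L := L) a b}

/-- The restriction of `M` to an `E`-class, as a structure in the language `L` (without `E`). -/
instance eClassStructure {M : Type u} [(withE L).Structure M] (a : M) :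
    L.Structure (EClass L a) where
  funMap {n} f := ((IsPredicate.isEmpty_functions (L := L) n).false f).elim
  RelMap R x := FirstOrder.Language.Structure.RelMap (L := withE L) (RelE.base R) (fun k => (x k).1)

variable (L) in
/-- `TH(M)`: the set of the complete theories of the `E`-classes of `M`. -/
def TH (M : Type u) [(withE L).Structure M] : Set L.Theory :=
  {S | ∃ a : M, S = L.completeTheory (EClass L a)}

/-- The set of the theories of all `E`-classes of all models of `T`. -/
def classTheories (T : (withE L).Theory) : Set L.Theory :=
  {S | ∃ M : FirstOrder.Language.Theory.ModelType.{0, u, u} T, S ∈ TH L M}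

variable (L) in
/-- The `e`-spectrum of a structure `M`: the number of pairwise elementarily non-equivalent
structures which are `E`-classes of structures elementarily equivalent to `M` and which are not
elementarily equivalent to any `E`-class of `M` itself. -/
noncomputable def eSpectrumOf (M : Type u) [(withE L).Structure M] : Cardinal.{u} :=
  #↥(classTheories ((withE L).completeTheory M) \ TH L M)

/-- The `e`-spectrum of a theory: the supremum of the `e`-spectra of its models. -/
noncomputable def eSpectrum (T : (withE L).Theory) : Cardinal.{u} :=
  sSup {κ | ∃ M : FirstOrder.Language.Theory.ModelType.{0, u, u} T, κ = eSpectrumOf L M}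

/-- The supremum in `eSpectrum` is a supremum of a bounded set. -/
theorem bddAbove_eSpectrum (T : (withE L).Theory) :
    BddAbove {κ | ∃ M : FirstOrder.Language.Theory.ModelType.{0, u, u} T, κ = eSpectrumOf L M} := by
  refine ⟨#L.Theory, ?_⟩
  rintro κ ⟨M, rfl⟩
  exact mk_set_le _

/-- `T` has an `e`-least model: a model `M` for which `TH(M)` is least among the sets `TH(N)`,
where `N` runs over the models of `T`. -/
def HasELeastModel (T : (withE L).Theory) : Prop :=
  ∃ M : FirstOrder.Language.Theory.ModelType.{0, u, u} T,
    ∀ N : FirstOrder.Language.Theory.ModelType.{0, u, u} T, TH L M ⊆ TH L N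

end Structures

section LanguageUniform

variable {L : FirstOrder.Language.{0, u}}

open FirstOrder.Language in
/-- The sentence `∃ x₁ … xₙ, R(x₁, …, xₙ)`. -/
def exSentence {n : ℕ} (R : L.Relations n) : L.Sentence :=
  (R.boundedFormula (fun k : Fin n => (Term.var (Sum.inr k) : L.Term (Empty ⊕ Fin n)))).exs

/-- `R` is a non-empty predicate for `T`. -/
def NonemptyFor (T : L.Theory) {n : ℕ} (R : L.Relations n) : Prop := T ⊨ᵇ exSentence R

/-- `R` is an empty predicate for `T`. -/
def EmptyFor (T : L.Theory) {n : ℕ} (R : L.Relations n) : Prop := T ⊨ᵇ (exSentence R).not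

/-- The renaming of the symbols of `L` which permutes the `n`-ary predicate symbols by `σ` and
fixes all the other symbols. -/
def permHom {n : ℕ} (σ : Equiv.Perm (L.Relations n)) : L →ᴸ L where
  onFunction _ f := f
  onRelation m R := if h : n = m then h ▸ σ (h.symm ▸ R) else R

/-- `T` is a language uniform theory: for each arity `n`, `T` is preserved by every permutation
of the set of the non-empty `n`-ary predicates. Such a permutation is given by a permutation of
all the `n`-ary predicate symbols that fixes those which are not non-empty for `T`. -/
def IsLU (T : L.Theory) : Prop :=
  ∀ (n : ℕ) (σ : Equiv.Perm (L.Relations n)), (∀ R, ¬ NonemptyFor T R → σ R = R) →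
    ∀ φ : L.Sentence, T ⊨ᵇ φ ↔ T ⊨ᵇ (permHom σ).onSentence φ

/-- `T` is an IILU-theory: a language uniform theory having non-empty predicates such that, for
every `n` for which there is a non-empty `n`-ary predicate, there are infinitely many non-empty
and infinitely many empty `n`-ary predicates. -/
def IsIILU (T : L.Theory) : Prop :=
  IsLU T ∧ (∃ (n : ℕ) (R : L.Relations n), NonemptyFor T R) ∧
    ∀ n : ℕ, (∃ R : L.Relations n, NonemptyFor T R) →
      {R : L.Relations n | NonemptyFor T R}.Infinite ∧ {R : L.Relations n | EmptyFor T R}.Infinite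

end LanguageUniform

/-- `T` is an `E`-combination of IILU-theories in the language `L`: the theory of `Comb_E (A i)`
for a non-empty family of (non-empty) `L`-structures `A i` whose theories are IILU-theories. -/
def IsECombinationOfIILU {L : FirstOrder.Language.{0, u}} [IsPredicate L] (T : (withE L).Theory) : Prop :=
  ∃ (ι : Type u) (_ : Nonempty ι) (A : ι → Type u) (_ : ∀ i, Nonempty (A i))
    (_ : ∀ i, L.Structure (A i)),
    (∀ i, IsIILU (L.completeTheory (A i))) ∧ T = (withE L).completeTheory (Σ i, A i)

end ECombination

open FirstOrder.Language FirstOrder.Language.Structure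

namespace ECombination

/-! Take one-element structures over a unary language. Each is a subset of `K`, and its theory is
language uniform. In their combination `E` is equality, hence also in every model of `T`, so the
theories of classes are the traces of elements: points of the Cantor space `2^K`. By compactness
(`classTheories_combTheory`) the traces occurring in models of `T` form the closure of the family.
An isolated member occurs in every model, so if all members are isolated, the combination is
`e`-least and `e-Sp(T)` counts the closure points outside the family (`eSpectrum_combTheory`).

It remains to build a discrete family with μ new limits: a sequence converging to its own limit for
each `j : J`, where `#J = μ`, and one more point that keeps the family non-empty when μ = 0. For
infinite `J` the limits may accumulate at one further point, which does not change the count. -/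

/-- The relation symbols of a language with only unary predicates, indexed by `K`. -/
inductive UnaryRel (K : Type u) : ℕ → Type u
  | mk (s : K) : UnaryRel K 1

/-- The language whose symbols are unary predicates indexed by `K`. -/
def unary (K : Type u) : FirstOrder.Language.{0, u} := ⟨fun _ => Empty, UnaryRel K⟩

/-- The unary predicate symbol indexed by `s`. -/
def predSym {K : Type u} (s : K) : (unary K).Relations 1 := UnaryRel.mk s

theorem predSym_injective (K : Type u) : Function.Injective (predSym (K := K)) :=
  fun s t h => by cases h; rfl

instance (K : Type u) : IsPredicate (unary K) where
  isEmpty_functions _ := inferInstanceAs (IsEmpty Empty)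
  isEmpty_nullary := ⟨fun R => nomatch R⟩

theorem card_unary (K : Type u) : (unary K).card = #K := by
  refine Cardinal.mk_congr
    { toFun := fun x => match x with
        | .inl f => (f.2 : Empty).elim
        | .inr ⟨_, UnaryRel.mk s⟩ => s
      invFun := fun s => .inr ⟨1, UnaryRel.mk s⟩
      left_inv := ?_
      right_inv := fun s => rfl }
  rintro (⟨n, f⟩ | ⟨n, ⟨s⟩⟩)
  · exact (f : Empty).elim
  · rfl

/-! ### One-element structures and their theories -/

/-- The one-element structure in which exactly the predicates from `S` hold. -/
def Point {K : Type u} (_S : Set K) : Type u := PUnit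

variable {K : Type u}

instance (S : Set K) : Unique (Point S) := inferInstanceAs (Unique PUnit)

instance pointStructure (S : Set K) : (unary K).Structure (Point S) where
  funMap f := (f : Empty).elim
  RelMap R _ := match R with
    | .mk s => s ∈ S

theorem relMap_predSym (S : Set K) (s : K) (x : Fin 1 → Point S) :
    RelMap (predSym s) x ↔ s ∈ S := Iff.rfl

/-- The complete theory of a one-element structure. -/
def pointTheory (S : Set K) : (unary K).Theory := (unary K).completeTheory (Point S)

theorem models_completeTheory_iff {L : FirstOrder.Language.{0, u}} {M : Type u} [L.Structure M]
    [Nonempty M] (φ : L.Sentence) : L.completeTheory M ⊨ᵇ φ ↔ M ⊨ φ :=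
  ((completeTheory.isComplete L M).realize_sentence_iff φ M).symm

theorem realize_exSentence {L : FirstOrder.Language.{0, u}} {M : Type u} [L.Structure M] {n : ℕ}
    (R : L.Relations n) : M ⊨ exSentence R ↔ ∃ x : Fin n → M, RelMap R x := by
  rw [exSentence, Sentence.Realize, BoundedFormula.realize_exs]
  simp only [BoundedFormula.realize_rel, Term.realize_var, Sum.elim_inr]

theorem nonemptyFor_pointTheory_iff (S : Set K) {n : ℕ} (R : (unary K).Relations n) :
    NonemptyFor (pointTheory S) R ↔ ∀ x : Fin n → Point S, RelMap R x := by
  rw [NonemptyFor, pointTheory, models_completeTheory_iff, realize_exSentence]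
  exact ⟨fun ⟨x, hx⟩ y => Subsingleton.elim x y ▸ hx, fun h => ⟨default, h _⟩⟩

theorem nonemptyFor_predSym_iff (S : Set K) (s : K) :
    NonemptyFor (pointTheory S) (predSym s) ↔ s ∈ S := by
  rw [nonemptyFor_pointTheory_iff]
  exact ⟨fun h => h default, fun h _ => h⟩

theorem emptyFor_predSym_iff (S : Set K) (s : K) :
    EmptyFor (pointTheory S) (predSym s) ↔ s ∉ S := by
  rw [← nonemptyFor_predSym_iff S, EmptyFor, NonemptyFor, pointTheory, models_completeTheory_iff,
    models_completeTheory_iff, Sentence.realize_not]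

theorem pointTheory_injective : Function.Injective (pointTheory (K := K)) := by
  intro S T h
  ext s
  rw [← nonemptyFor_predSym_iff S, h, nonemptyFor_predSym_iff]

/-- On one point a non-empty predicate holds everywhere, so permuting the non-empty predicates
leaves every interpretation unchanged. -/
theorem isLU_pointTheory (S : Set K) : IsLU (pointTheory S) := by
  intro n σ hσ φ
  have key : ∀ (R : (unary K).Relations n) (x : Fin n → Point S),
      RelMap (σ R) x ↔ RelMap R x := by
    have h1 : ∀ R, NonemptyFor (pointTheory S) (σ R) ↔ NonemptyFor (pointTheory S) R := by
      intro R
      by_cases h : NonemptyFor (pointTheory S) (σ R)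
      · refine iff_of_true h ?_
        by_contra h'
        exact h' (hσ R h' ▸ h)
      · have : σ R = R := σ.injective (hσ _ h)
        rw [this]
    intro R x
    have h2 := h1 R
    simp only [nonemptyFor_pointTheory_iff] at h2
    constructor
    · intro h
      exact h2.1 (fun y => Subsingleton.elim x y ▸ h) x
    · intro h
      exact h2.2 (fun y => Subsingleton.elim x y ▸ h) x
  have : (permHom σ).IsExpansionOn (Point S) :=
    { map_onFunction := fun f _ => (f : Empty).elim
      map_onRelation := by
        intro m R x
        by_cases h : n = m
        · subst h
          simp only [permHom, dite_true]
          exact propext (key R x)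
        · simp only [permHom, dif_neg h] }
  rw [pointTheory, models_completeTheory_iff, models_completeTheory_iff,
    LHom.realize_onSentence]

theorem isIILU_pointTheory {S : Set K} (hS : S.Infinite) (hS' : Sᶜ.Infinite) :
    IsIILU (pointTheory S) := by
  refine ⟨isLU_pointTheory S, ?_, ?_⟩
  · obtain ⟨s, hs⟩ := hS.nonempty
    exact ⟨1, predSym s, (nonemptyFor_predSym_iff S s).2 hs⟩
  · rintro _ ⟨⟨s⟩, -⟩
    constructor
    · refine (hS.image (predSym_injective K).injOn).mono ?_
      rintro _ ⟨s, hs, rfl⟩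
      exact (nonemptyFor_predSym_iff S s).2 hs
    · refine (hS'.image (predSym_injective K).injOn).mono ?_
      rintro _ ⟨s, hs, rfl⟩
      exact (emptyFor_predSym_iff S s).2 hs

/-! ### Traces in models of the combination -/

section Trace

/-- The symbol of `withE (unary K)` for the unary predicate indexed by `s`. -/
def predSymE (s : K) : (withE (unary K)).Relations 1 := RelE.base (predSym s)

/-- The set of the unary predicates that hold of `b`. -/
def trace {M : Type u} [(withE (unary K)).Structure M] (b : M) : Set K :=
  {s | RelMap (predSymE s) ![b]}

/-- The relation `E` of `M` is equality. -/
def EIsEq (K : Type u) (M : Type u) [(withE (unary K)).Structure M] : Prop :=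
  ∀ a b : M, relE (L := unary K) a b ↔ a = b

theorem EIsEq.of_elementarilyEquivalent {M N : Type u} [(withE (unary K)).Structure M]
    [(withE (unary K)).Structure N] (hM : EIsEq K M) (h : M ≅[withE (unary K)] N) : EIsEq K N := by
  let R : (withE (unary K)).Relations 2 := RelE.E
  let φ : (withE (unary K)).Sentence :=
    ((R.boundedFormula₂ (&0) (&1)).iff ((&0 : (withE (unary K)).Term (Empty ⊕ Fin 2)) =' &1)).alls
  have hφ : ∀ (P : Type u) [(withE (unary K)).Structure P], P ⊨ φ ↔ EIsEq K P := by
    intro P _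
    simp only [φ, Sentence.Realize, BoundedFormula.realize_alls, BoundedFormula.realize_iff,
      BoundedFormula.realize_rel₂, BoundedFormula.realize_bdEqual]
    exact ⟨fun h a b => h ![a, b], fun h x => h (x 0) (x 1)⟩
  exact (hφ N).1 ((h.realize_sentence φ).1 ((hφ M).2 hM))

/-- In elementarily equivalent structures, the same finite parts of traces occur. -/
theorem exists_trace_eqOn {M N : Type u} [(withE (unary K)).Structure M]
    [(withE (unary K)).Structure N] (h : M ≅[withE (unary K)] N) (F : Finset K) (a : M) :
    ∃ b : N, ∀ s ∈ F, s ∈ trace b ↔ s ∈ trace a := by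
  classical
  let ψ : F → (withE (unary K)).BoundedFormula Empty 1 := fun s =>
    if (s : K) ∈ trace a then (predSymE (s : K)).boundedFormula₁ (&0)
    else ((predSymE (s : K)).boundedFormula₁ (&0)).not
  let φ : (withE (unary K)).Sentence := (BoundedFormula.iInf ψ).exs
  have hφ : ∀ (P : Type u) [(withE (unary K)).Structure P],
      P ⊨ φ ↔ ∃ b : P, ∀ s ∈ F, s ∈ trace b ↔ s ∈ trace a := by
    intro P _
    have hψ : ∀ (x : Fin 1 → P) (s : F),
        (ψ s).Realize (default : Empty → P) x ↔ ((s : K) ∈ trace (x 0) ↔ (s : K) ∈ trace a) := by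
      intro x s
      by_cases hs : (s : K) ∈ trace a
      · simp only [ψ, if_pos hs, BoundedFormula.realize_rel₁, hs, iff_true]
        rfl
      · simp only [ψ, if_neg hs, BoundedFormula.realize_not, BoundedFormula.realize_rel₁, hs,
          iff_false]
        rfl
    rw [Sentence.Realize, BoundedFormula.realize_exs]
    simp only [BoundedFormula.realize_iInf, hψ, Subtype.forall]
    exact ⟨fun ⟨x, hx⟩ => ⟨x 0, hx⟩, fun ⟨b, hb⟩ => ⟨fun _ => b, hb⟩⟩
  exact (hφ N).1 ((h.realize_sentence φ).1 ((hφ M).2 ⟨a, fun _ _ => Iff.rfl⟩))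

theorem completeTheory_eClass {M : Type u} [(withE (unary K)).Structure M] (hM : EIsEq K M)
    (a : M) : (unary K).completeTheory (EClass (unary K) a) = pointTheory (trace a) := by
  let e : EClass (unary K) a ≃[unary K] Point (trace a) :=
    { toFun := fun _ => default
      invFun := fun _ => ⟨a, (hM a a).2 rfl⟩
      left_inv := fun b => Subtype.ext ((hM a b.1).1 b.2)
      right_inv := fun _ => Subsingleton.elim _ _
      map_fun' := fun f _ => (f : Empty).elim
      map_rel' := by
        rintro _ ⟨s⟩ x
        have : (fun k => (x k).1) = ![a] := funext fun k => by
          rw [← (hM a _).1 (x k).2, Subsingleton.elim k 0]; rfl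
        refine (relMap_predSym (trace a) s _).trans ?_
        change s ∈ trace a ↔ RelMap (predSymE s) (fun k => (x k).1)
        rw [this]
        rfl }
  exact StrongHomClass.elementarilyEquivalent e

theorem TH_eq {M : Type u} [(withE (unary K)).Structure M] (hM : EIsEq K M) :
    TH (unary K) M = pointTheory '' Set.range (trace (K := K) (M := M)) := by
  ext S
  rw [← Set.range_comp]
  refine exists_congr fun a => ?_
  rw [completeTheory_eClass hM, eq_comm]
  rfl

/-- The `E`-combination of one-element structures. -/
abbrev Comb {ι : Type u} (S : ι → Set K) : Type u := Σ i, Point (S i)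

variable {ι : Type u} (S : ι → Set K)

theorem eIsEq_comb : EIsEq K (Comb S) := by
  rintro ⟨i, a⟩ ⟨j, b⟩
  constructor
  · intro h
    obtain rfl : i = j := h
    rw [Subsingleton.elim a b]
  · intro h
    rw [h]
    rfl

theorem trace_comb (x : Comb S) : trace (K := K) x = S x.1 := by
  ext s
  constructor
  · rintro ⟨i, y, hy, hs⟩
    have : x = ⟨i, y 0⟩ := hy 0
    rw [this]
    exact hs
  · intro h
    exact ⟨x.1, fun _ => x.2, fun k => by rw [Subsingleton.elim k 0]; rfl, h⟩

theorem range_trace_comb : Set.range (trace (K := K) (M := Comb S)) = Set.range S := by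
  ext T
  constructor
  · rintro ⟨x, rfl⟩
    exact ⟨x.1, (trace_comb S x).symm⟩
  · rintro ⟨i, rfl⟩
    exact ⟨⟨i, default⟩, trace_comb S _⟩

/-- The sets all of whose finite parts coincide with those of members of the family `S`. -/
def finClosure : Set (Set K) := {A | ∀ F : Finset K, ∃ i, ∀ s ∈ F, s ∈ S i ↔ s ∈ A}

variable {S}

theorem trace_mem_finClosure {M : Type u} [(withE (unary K)).Structure M]
    (h : Comb S ≅[withE (unary K)] M) (b : M) : trace b ∈ finClosure S := by
  intro F
  obtain ⟨x, hx⟩ := exists_trace_eqOn h.symm F b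
  exact ⟨x.1, fun s hs => by rw [← hx s hs, trace_comb]⟩

/-- In an ultrapower over the finite subsets of `K`, the class of a choice of approximations to `A`
has trace exactly `A`. -/
theorem exists_trace_eq_of_mem_finClosure {A : Set K} (hA : A ∈ finClosure S) :
    ∃ (M : Type u) (_ : (withE (unary K)).Structure M) (_ : Comb S ≅[withE (unary K)] M) (b : M),
      trace b = A := by
  classical
  choose i hi using hA
  let x : Finset K → Comb S := fun F => ⟨i F, default⟩
  have : Nonempty (Comb S) := ⟨x ∅⟩
  let U : Ultrafilter (Finset K) := Ultrafilter.of Filter.atTop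
  refine ⟨(U : Filter (Finset K)).Product fun _ => Comb S, inferInstance, ?_,
    (x : (U : Filter (Finset K)).Product fun _ => Comb S), ?_⟩
  · rw [elementarilyEquivalent_iff]
    intro φ
    rw [Ultraproduct.sentence_realize, Filter.eventually_const]
  · ext s
    have h := Ultraproduct.realize_formula_cast (u := U) (M := fun _ : Finset K => Comb S)
      ((predSymE s).formula₁ (Term.var (0 : Fin 1))) (fun _ => x)
    simp only [Formula.realize_rel₁, Term.realize_var] at h
    -- `U` refines `atTop`, so almost every `F` contains `s`, and there `x F` decides `s` as `A`
    -- does.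
    have hU : ∀ᶠ F in (U : Filter (Finset K)), s ∈ F :=
      Ultrafilter.of_le Filter.atTop ((Filter.eventually_ge_atTop {s}).mono fun F hF =>
        hF (Finset.mem_singleton_self s))
    refine h.trans ((Filter.eventually_congr (hU.mono fun F hF => ?_)).trans
      Filter.eventually_const)
    exact (Set.ext_iff.1 (trace_comb S (x F)) s).trans (hi F s hF)

/-- The member `S i` of the family is isolated in it by finitely many predicates. -/
def Isolated (S : ι → Set K) (i : ι) : Prop :=
  ∃ F : Finset K, ∀ j, (∀ s ∈ F, s ∈ S j ↔ s ∈ S i) → S j = S i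

/-- Some `b` agrees with `S i` on the isolating set `F`. For each `s`, a member agreeing with `trace
b` on `F ∪ {s}` must be `S i`, which settles `s`. -/
theorem Isolated.exists_trace_eq {i : ι} (hi : Isolated S i) {M : Type u}
    [(withE (unary K)).Structure M] (h : Comb S ≅[withE (unary K)] M) :
    ∃ b : M, trace b = S i := by
  classical
  obtain ⟨F, hF⟩ := hi
  obtain ⟨b, hb⟩ := exists_trace_eqOn h F ⟨i, default⟩
  rw [trace_comb] at hb
  refine ⟨b, Set.ext fun s => ?_⟩
  obtain ⟨j, hj⟩ := trace_mem_finClosure h b (insert s F)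
  rw [← hj s (Finset.mem_insert_self s F),
    hF j fun t ht => (hj t (Finset.mem_insert_of_mem ht)).trans (hb t ht)]

end Trace

/-! ### The e-spectrum as a count of new limit points -/

section Spectrum

variable {ι : Type u} (S : ι → Set K)

/-- The theory of the `E`-combination of one-element structures. -/
abbrev combTheory : (withE (unary K)).Theory := (withE (unary K)).completeTheory (Comb S)

variable {S}

theorem elementarilyEquivalent_of_model
    (M : FirstOrder.Language.Theory.ModelType.{0, u, u} (combTheory S)) :
    Comb S ≅[withE (unary K)] M :=
  elementarilyEquivalent_iff.2 fun φ =>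
    (realize_iff_of_model_completeTheory (Comb S) M φ).symm

theorem isECombinationOfIILU_combTheory [Nonempty ι] (hS : ∀ i, (S i).Infinite)
    (hS' : ∀ i, (S i)ᶜ.Infinite) : IsECombinationOfIILU (combTheory S) :=
  ⟨ι, inferInstance, fun i => Point (S i), fun _ => inferInstance, fun _ => inferInstance,
    fun i => isIILU_pointTheory (hS i) (hS' i), rfl⟩

theorem TH_comb : TH (unary K) (Comb S) = pointTheory '' Set.range S := by
  rw [TH_eq (eIsEq_comb S), range_trace_comb]

theorem classTheories_combTheory :
    classTheories (combTheory S) = pointTheory '' finClosure S := by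
  ext T
  constructor
  · rintro ⟨M, hM⟩
    have h := elementarilyEquivalent_of_model M
    rw [TH_eq ((eIsEq_comb S).of_elementarilyEquivalent h)] at hM
    obtain ⟨_, ⟨b, rfl⟩, rfl⟩ := hM
    exact ⟨_, trace_mem_finClosure h b, rfl⟩
  · rintro ⟨A, hA, rfl⟩
    obtain ⟨M, _, h, b, rfl⟩ := exists_trace_eq_of_mem_finClosure hA
    have : M ⊨ combTheory S := h.theory_model
    have : Nonempty M := ⟨b⟩
    refine ⟨Theory.ModelType.of _ M, ?_⟩
    change pointTheory (trace b) ∈ TH (unary K) M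
    rw [TH_eq ((eIsEq_comb S).of_elementarilyEquivalent h)]
    exact ⟨_, ⟨b, rfl⟩, rfl⟩

theorem TH_comb_subset (hS : ∀ i, Isolated S i)
    (M : FirstOrder.Language.Theory.ModelType.{0, u, u} (combTheory S)) :
    TH (unary K) (Comb S) ⊆ TH (unary K) M := by
  have h := elementarilyEquivalent_of_model M
  rw [TH_comb, TH_eq ((eIsEq_comb S).of_elementarilyEquivalent h)]
  refine Set.image_mono ?_
  rintro _ ⟨i, rfl⟩
  exact (hS i).exists_trace_eq h

theorem hasELeastModel_combTheory [Nonempty ι] (hS : ∀ i, Isolated S i) :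
    HasELeastModel (combTheory S) :=
  have : Nonempty (Comb S) := ‹Nonempty ι›.map fun i => ⟨i, default⟩
  ⟨Theory.ModelType.of (combTheory S) (Comb S), TH_comb_subset hS⟩

theorem eSpectrumOf_comb :
    eSpectrumOf (unary K) (Comb S) = #↥(finClosure S \ Set.range S) := by
  rw [eSpectrumOf, classTheories_combTheory, TH_comb, ← Set.image_sdiff pointTheory_injective,
    mk_image_eq pointTheory_injective]

/-- All models share the same class theories, so the supremum is attained where the fewest are
realized, at the `e`-least model. -/
theorem eSpectrum_combTheory [Nonempty ι] (hS : ∀ i, Isolated S i) :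
    eSpectrum (combTheory S) = #↥(finClosure S \ Set.range S) := by
  have : Nonempty (Comb S) := ‹Nonempty ι›.map fun i => ⟨i, default⟩
  rw [← eSpectrumOf_comb]
  refine IsGreatest.csSup_eq ⟨⟨Theory.ModelType.of (combTheory S) (Comb S), rfl⟩, ?_⟩
  rintro _ ⟨M, rfl⟩
  have h : combTheory S = (withE (unary K)).completeTheory M := elementarilyEquivalent_of_model M
  rw [eSpectrumOf, eSpectrumOf, ← h]
  exact mk_le_mk_of_subset (Set.sdiff_subset_sdiff_right (TH_comb_subset hS M))

end Spectrum

/-! ### A discrete family with prescribed limits -/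

section Sequences

/-- The index set of the predicates used for a family of convergent sequences, one for each
element of `J`. -/
inductive SeqSym (J : Type u) : Type u
  | mark : SeqSym J
  | cls (j : J) : SeqSym J
  | pt (j : J) (n : ℕ) : SeqSym J
  | pos (n : ℕ) : SeqSym J
  | neg (n : ℕ) : SeqSym J

variable {J : Type u}

theorem mk_seqSym (J : Type u) : #(SeqSym J) = max #J ℵ₀ := by
  let e : SeqSym J ≃ (Option J ⊕ J × ℕ) ⊕ ℕ ⊕ ℕ :=
    { toFun := fun s => match s with
        | .mark => .inl (.inl none)
        | .cls j => .inl (.inl (some j))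
        | .pt j n => .inl (.inr (j, n))
        | .pos n => .inr (.inl n)
        | .neg n => .inr (.inr n)
      invFun := fun x => match x with
        | .inl (.inl none) => .mark
        | .inl (.inl (some j)) => .cls j
        | .inl (.inr (j, n)) => .pt j n
        | .inr (.inl n) => .pos n
        | .inr (.inr n) => .neg n
      left_inv := by rintro (_ | _ | _ | _ | _) <;> rfl
      right_inv := by rintro (((_ | _) | ⟨_, _⟩) | (_ | _)) <;> rfl }
  rw [mk_congr e]
  simp only [mk_sum, mk_option, mk_prod, lift_id, mk_nat, lift_aleph0, lift_uzero,
    aleph0_add_aleph0]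
  rcases lt_or_ge #J ℵ₀ with h | h
  · rw [max_eq_right h.le, add_eq_right le_rfl]
    exact add_le_of_le le_rfl (add_le_of_le le_rfl h.le one_le_aleph0)
      (mul_le_of_le le_rfl h.le le_rfl)
  · rw [max_eq_left h, mul_aleph0_eq h, add_one_eq h, add_eq_self h, add_eq_left h h]

/-- An isolated point, and for each `j : J` a sequence converging to `seqLimit (some j)`. -/
def seqFamily (i : Option (J × ℕ)) : Set (SeqSym J) :=
  {s | match s with
    | .mark => i = none
    | .cls j => ∃ n, i = some (j, n)
    | .pt j n => i = some (j, n)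
    | .pos _ => True
    | .neg _ => False}

/-- The limits of the sequences, and the limit `seqLimit none` of these limits. -/
def seqLimit (o : Option J) : Set (SeqSym J) :=
  {s | match s with
    | .mark => False
    | .cls j => o = some j
    | .pt _ _ => False
    | .pos _ => True
    | .neg _ => False}

/-- The symbols `pos` and `neg` serve only the IILU condition: they take constant values on the
family. -/
theorem infinite_seqFamily (i : Option (J × ℕ)) : (seqFamily i).Infinite :=
  (Set.infinite_range_of_injective (f := (SeqSym.pos : ℕ → SeqSym J))
    fun _ _ h => by cases h; rfl).mono (by rintro _ ⟨n, rfl⟩; trivial)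

theorem infinite_compl_seqFamily (i : Option (J × ℕ)) : (seqFamily i)ᶜ.Infinite :=
  (Set.infinite_range_of_injective (f := (SeqSym.neg : ℕ → SeqSym J))
    fun _ _ h => by cases h; rfl).mono (by rintro _ ⟨n, rfl⟩; exact id)

theorem isolated_seqFamily (i : Option (J × ℕ)) : Isolated seqFamily i := by
  rcases i with _ | ⟨j, n⟩
  · refine ⟨{.mark}, fun k hk => ?_⟩
    have : k = none := (hk _ (Finset.mem_singleton_self _)).2 rfl
    rw [this]
  · refine ⟨{.pt j n}, fun k hk => ?_⟩
    have : k = some (j, n) := (hk _ (Finset.mem_singleton_self _)).2 rfl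
    rw [this]

theorem seqLimit_injective : Function.Injective (seqLimit (J := J)) := by
  intro o o' h
  refine Option.ext fun j => ?_
  exact Set.ext_iff.1 h (.cls j)

theorem seqLimit_notMem_range (o : Option J) : seqLimit o ∉ Set.range (seqFamily (J := J)) := by
  rintro ⟨_ | ⟨j, n⟩, h⟩
  · exact (Set.ext_iff.1 h .mark).1 rfl
  · exact (Set.ext_iff.1 h (.pt j n)).1 rfl

theorem seqLimit_some_mem_finClosure (j : J) : seqLimit (some j) ∈ finClosure seqFamily := by
  intro F
  -- Among `cls`, `pos`, `neg`, `mark` the `n`-th term already agrees with the limit; only `pt j n`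
  -- must be avoided.
  obtain ⟨n, hn⟩ : ∃ n, SeqSym.pt j n ∉ F := by
    by_contra! h
    exact Set.infinite_of_injective_forall_mem (f := SeqSym.pt j)
      (fun _ _ h => by cases h; rfl) h F.finite_toSet
  refine ⟨some (j, n), ?_⟩
  rintro (_ | k | ⟨k, m⟩ | m | m) hs
  · exact iff_of_false nofun nofun
  · change (∃ m, some (j, n) = some (k, m)) ↔ some j = some k
    simp
  · refine iff_of_false (fun h => ?_) nofun
    cases h
    exact hn hs
  · exact Iff.rfl
  · exact Iff.rfl

theorem mem_iff_of_mem_finClosure {ι : Type u} {S : ι → Set K} {A : Set K}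
    (hA : A ∈ finClosure S) {s : K} (hs : s ∈ A) (t : K) : ∃ i, s ∈ S i ∧ (t ∈ S i ↔ t ∈ A) := by
  classical
  obtain ⟨i, hi⟩ := hA {s, t}
  exact ⟨i, (hi s (by simp)).2 hs, hi t (by simp)⟩

/-- `mark` and each `pt j n` single out a member, so a new closure point contains none of them. The
`cls j` are pairwise exclusive, so it contains at most one, which determines the limit. -/
theorem eq_seqLimit_of_mem_finClosure {A : Set (SeqSym J)} (hA : A ∈ finClosure seqFamily)
    (hA' : A ∉ Set.range seqFamily) : ∃ o, A = seqLimit o := by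
  have hmark : SeqSym.mark ∉ A := fun h => hA' ⟨none, Set.ext fun t => by
    obtain ⟨i, hi, ht⟩ := mem_iff_of_mem_finClosure hA h t
    obtain rfl : i = none := hi
    exact ht⟩
  have hpt : ∀ j n, SeqSym.pt j n ∉ A := fun j n h => hA' ⟨some (j, n), Set.ext fun t => by
    obtain ⟨i, hi, ht⟩ := mem_iff_of_mem_finClosure hA h t
    obtain rfl : i = some (j, n) := hi
    exact ht⟩
  have hpos : ∀ n, SeqSym.pos n ∈ A := fun n => by
    obtain ⟨i, hi⟩ := hA {.pos n}
    exact (hi _ (Finset.mem_singleton_self _)).1 trivial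
  have hneg : ∀ n, SeqSym.neg n ∉ A := fun n h => by
    obtain ⟨i, hi⟩ := hA {.neg n}
    exact (hi _ (Finset.mem_singleton_self _)).2 h
  suffices ∃ o : Option J, ∀ j, SeqSym.cls j ∈ A ↔ o = some j by
    obtain ⟨o, ho⟩ := this
    refine ⟨o, Set.ext ?_⟩
    rintro (_ | j | ⟨j, n⟩ | n | n)
    · exact iff_of_false hmark id
    · exact ho j
    · exact iff_of_false (hpt j n) id
    · exact iff_of_true (hpos n) trivial
    · exact iff_of_false (hneg n) id
  by_cases h : ∃ j, SeqSym.cls j ∈ A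
  · obtain ⟨j, hj⟩ := h
    refine ⟨some j, fun k => ?_⟩
    obtain ⟨i, ⟨n, rfl⟩, hk⟩ := mem_iff_of_mem_finClosure hA hj (.cls k)
    rw [← hk]
    change (∃ m, some (j, n) = some (k, m)) ↔ some j = some k
    simp
  · exact ⟨none, fun j => iff_of_false (fun hj => h ⟨j, hj⟩) nofun⟩

/-- Every member satisfies `mark` or some `cls j`; for finite `J` this is a finite condition, which
`seqLimit none` violates. -/
theorem seqLimit_none_notMem_finClosure [Finite J] :
    seqLimit (none : Option J) ∉ finClosure seqFamily := by
  classical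
  have := Fintype.ofFinite J
  intro h
  obtain ⟨i, hi⟩ := h (insert .mark (Finset.univ.image SeqSym.cls))
  rcases i with _ | ⟨j, n⟩
  · exact (hi .mark (Finset.mem_insert_self _ _)).1 rfl
  · have := (hi (.cls j) (Finset.mem_insert_of_mem
      (Finset.mem_image_of_mem _ (Finset.mem_univ j)))).1 ⟨n, rfl⟩
    exact nomatch (this : none = some j)

theorem mk_finClosure_sdiff_range :
    #↥(finClosure (seqFamily (J := J)) \ Set.range seqFamily) = #J := by
  refine le_antisymm ?_ ?_
  · rcases finite_or_infinite J with hJ | hJ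
    · have h : finClosure (seqFamily (J := J)) \ Set.range seqFamily ⊆
          Set.range fun j : J => seqLimit (some j) := by
        rintro A ⟨hA, hA'⟩
        obtain ⟨_ | j, rfl⟩ := eq_seqLimit_of_mem_finClosure hA hA'
        · exact absurd hA seqLimit_none_notMem_finClosure
        · exact ⟨j, rfl⟩
      exact (mk_le_mk_of_subset h).trans mk_range_le
    · have h : finClosure (seqFamily (J := J)) \ Set.range seqFamily ⊆
          Set.range (seqLimit (J := J)) := by
        rintro A ⟨hA, hA'⟩
        obtain ⟨o, rfl⟩ := eq_seqLimit_of_mem_finClosure hA hA'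
        exact ⟨o, rfl⟩
      refine ((mk_le_mk_of_subset h).trans mk_range_le).trans ?_
      rw [mk_option, add_one_eq (aleph0_le_mk J)]
  · refine mk_le_of_injective (f := fun j : J => (⟨seqLimit (some j),
      seqLimit_some_mem_finClosure j, seqLimit_notMem_range _⟩ :
      ↥(finClosure (seqFamily (J := J)) \ Set.range seqFamily))) fun j k h => ?_
    exact Option.some_injective _ (seqLimit_injective (Subtype.ext_iff.1 h))

end Sequences

/-- Handles both ranges at once, since `max μ ℵ₀` is `ℵ₀` for μ ≤ ω and μ above. -/
theorem exists_eCombination_eSpectrum_eq (μ : Cardinal.{u}) :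
    ∃ (L : FirstOrder.Language.{0, u}) (_ : IsPredicate L) (T : (withE L).Theory),
      L.card = max μ ℵ₀ ∧ IsECombinationOfIILU T ∧ HasELeastModel T ∧ eSpectrum T = μ := by
  induction μ using Cardinal.inductionOn with | _ J
  refine ⟨unary (SeqSym J), inferInstance, combTheory seqFamily, ?_, ?_, ?_, ?_⟩
  · rw [card_unary, mk_seqSym]
  · exact isECombinationOfIILU_combTheory infinite_seqFamily infinite_compl_seqFamily
  · exact hasELeastModel_combTheory isolated_seqFamily
  · rw [eSpectrum_combTheory isolated_seqFamily, mk_finClosure_sdiff_range]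

end ECombination

theorem proposition5p2 :
    (∀ μ : Cardinal.{u}, μ ≤ Cardinal.aleph0 →
      ∃ (L : FirstOrder.Language.{0, u}) (_ : ECombination.IsPredicate L)
        (T : (ECombination.withE L).Theory),
        L.card = Cardinal.aleph0 ∧ ECombination.IsECombinationOfIILU T ∧
          ECombination.HasELeastModel T ∧ ECombination.eSpectrum T = μ) ∧
    (∀ lam : Cardinal.{u}, Cardinal.aleph0 < lam →
      ∃ (L : FirstOrder.Language.{0, u}) (_ : ECombination.IsPredicate L)
        (T : (ECombination.withE L).Theory),
        L.card = lam ∧ ECombination.IsECombinationOfIILU T ∧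
          ECombination.HasELeastModel T ∧ ECombination.eSpectrum T = lam) := by
  refine ⟨fun μ hμ => ?_, fun lam hlam => ?_⟩
  · obtain ⟨L, hL, T, hcard, h⟩ := ECombination.exists_eCombination_eSpectrum_eq μ
    exact ⟨L, hL, T, hcard.trans (max_eq_right hμ), h⟩
  · obtain ⟨L, hL, T, hcard, h⟩ := ECombination.exists_eCombination_eSpectrum_eq lam
    exact ⟨L, hL, T, hcard.trans (max_eq_left hlam.le), h⟩
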